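/- Let $m,n\in\mathbb{N}$ with $m\ge 1$, and fix a set $E\subset\mathbb{R}^n$. Let the rows $a_1,\dots,a_m$ of a random matrix $A\in\mathbb{R}^{m\times n}$ be independent copies of a random vector $a\in\mathbb{R}^n$. Let $B\in\mathbb{R}^{\lfloor m/2\rfloor\times n}$ be the matrix with rows $b_i=(a_{2i-1}-a_{2i})/\sqrt2$, $1\le i\le\lfloor m/2\rfloor$, and let $b=(a-a')/\sqrt2$, where $a'$ is an independent copy of $a$, so that each $b_i$ is distributed as $b$. Let $\epsilon_1,\dots,\epsilon_{\lfloor m/2\rfloor}$ be a Rademacher sequence (independent signs, each $\pm1$ with probability $1/2$) independent of $A$, and put $h=\frac{1}{\sqrt{\lfloor m/2\rfloor}}\sum_{k=1}^{\lfloor m/2\rfloor}\epsilon_k b_k$ (with $h=0$ if $m=1$). For $\xi>0$ define $$Q_{\xi}(E,b)=\inf_{u\in E}\mathbb{P}\left(|\langle b,u\rangle|\ge\xi\right),\qquad W_{\lfloor m/2\rfloor}(E,b)=\mathbb{E}\left[\sup_{u\in E}\langle h,u\rangle\right],$$ and assume that the expectation defining $W_{\lfloor m/2\rfloor}(E,b)$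 exists in $[-\infty,\infty]$, i.e. that the positive or the negative part of $\sup_{u\in E}\langle h,u\rangle$ has finite expectation. Then for all $t>0$ and $\xi>0$, with probability at least $1-e^{-2t^2}$, $$\inf_{v\in E}\|Av\|_2\ \ge\ \xi\sqrt{\frac{m-1}{2}}\;Q_{2\xi}(E,b)-\xi t-2W_{\lfloor m/2\rfloor}(E,b).$$ -/

import Mathlib

open MeasureTheory ProbabilityTheory
open scoped ENNReal

noncomputable section

namespace SmallBall

/-- Expectation of an extended-real random variable, `E[X⁺] - E[X⁻]`, with values in `[-∞, ∞]`.
It is meaningful when `ExpectationExists μ X`. -/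
def expectation {Ω : Type*} [MeasurableSpace Ω] (μ : Measure Ω) (X : Ω → EReal) : EReal :=
  ((∫⁻ ω, (X ω).toENNReal ∂μ : ℝ≥0∞) : EReal) - ((∫⁻ ω, (-X ω).toENNReal ∂μ : ℝ≥0∞) : EReal)

/-- The expectation is not of the undefined form `∞ - ∞`. -/
def ExpectationExists {Ω : Type*} [MeasurableSpace Ω] (μ : Measure Ω) (X : Ω → EReal) : Prop :=
  ∫⁻ ω, (X ω).toENNReal ∂μ ≠ ∞ ∨ ∫⁻ ω, (-X ω).toENNReal ∂μ ≠ ∞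

/-- The `i`-th row of a matrix, as a vector of Euclidean space. -/
def row {m n : ℕ} (A : Matrix (Fin m) (Fin n) ℝ) (i : Fin m) : EuclideanSpace ℝ (Fin n) :=
  WithLp.toLp 2 (A i)

/-- The matrix with the `⌊m/2⌋` rows `(a_{2i-1} - a_{2i}) / √2`, `1 ≤ i ≤ ⌊m/2⌋`
(in zero-based indexing, `(a_{2i} - a_{2i+1}) / √2`, `0 ≤ i < ⌊m/2⌋`). -/
def debias {m n : ℕ} (A : Matrix (Fin m) (Fin n) ℝ) : Matrix (Fin (m / 2)) (Fin n) ℝ :=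
  fun i j => (A ⟨2 * i.1, by omega⟩ j - A ⟨2 * i.1 + 1, by omega⟩ j) / √2

/-- The random vector `b = (a - a') / √2`, where `a'` is an independent copy of `a`,
realized on the product space. -/
def debiasedVector {Ω₀ : Type*} {n : ℕ} (a : Ω₀ → EuclideanSpace ℝ (Fin n)) :
    Ω₀ × Ω₀ → EuclideanSpace ℝ (Fin n) :=
  fun p => (√2)⁻¹ • (a p.1 - a p.2)

/-- `Q_ξ(E, X) = inf_{u ∈ E} P(|⟨X, u⟩| ≥ ξ)`. -/
def Q {Ω : Type*} [MeasurableSpace Ω] {n : ℕ} (μ : Measure Ω) (ξ : ℝ)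
    (E : Set (EuclideanSpace ℝ (Fin n))) (X : Ω → EuclideanSpace ℝ (Fin n)) : ℝ :=
  ⨅ u : E, μ.real {ω | ξ ≤ |inner ℝ (X ω) (u : EuclideanSpace ℝ (Fin n))|}

/-- The law of a Rademacher variable: `1` or `-1` with probability `1/2` each. -/
def rademacher : Measure ℝ :=
  (2⁻¹ : ℝ≥0∞) • Measure.dirac 1 + (2⁻¹ : ℝ≥0∞) • Measure.dirac (-1)

/-- The law of a Rademacher sequence of length `N`. -/
def rademacherSeq (N : ℕ) : Measure (Fin N → ℝ) :=
  Measure.pi fun _ => rademacher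

/-- `h = N^{-1/2} ∑_k ε_k b_k`, where `b_1, …, b_N` are the rows of `B`. -/
def h {N n : ℕ} (B : Matrix (Fin N) (Fin n) ℝ) (ε : Fin N → ℝ) : EuclideanSpace ℝ (Fin n) :=
  (√(N : ℝ))⁻¹ • ∑ k, ε k • row B k

/-- `sup_{u ∈ E} ⟨x, u⟩` in `[-∞, ∞]`. -/
def supInner {n : ℕ} (E : Set (EuclideanSpace ℝ (Fin n))) (x : EuclideanSpace ℝ (Fin n)) : EReal :=
  ⨆ u ∈ E, ((inner ℝ x u : ℝ) : EReal)

/-- `W_N(E, b) = E[sup_{u ∈ E} ⟨h, u⟩]` for a random matrix `B` with rows `b_1, …, b_N`. The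
Rademacher sequence is independent of `B`, hence the product measure. -/
def W {Ω : Type*} [MeasurableSpace Ω] {N n : ℕ} (μ : Measure Ω)
    (E : Set (EuclideanSpace ℝ (Fin n))) (B : Ω → Matrix (Fin N) (Fin n) ℝ) : EReal :=
  expectation (μ.prod (rademacherSeq N)) fun p => supInner E (h (B p.1) p.2)

/-- The expectation defining `W` exists in `[-∞, ∞]`. -/
def WExists {Ω : Type*} [MeasurableSpace Ω] {N n : ℕ} (μ : Measure Ω)
    (E : Set (EuclideanSpace ℝ (Fin n))) (B : Ω → Matrix (Fin N) (Fin n) ℝ) : Prop :=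
  ExpectationExists (μ.prod (rademacherSeq N)) fun p => supInner E (h (B p.1) p.2)

end SmallBall

end

/-! This is the small ball method, applied to differences of rows. Put `N = m / 2` and let `b_i` be
the rows of `debias A`. Since `(x - y)² / 2 ≤ x² + y²`, Cauchy–Schwarz gives `‖A v‖ ≥ N^{-1/2} ∑
|⟨b_i, v⟩|` (`inv_sqrt_mul_sum_abs_inner_le_norm`), so a lower bound for this empirical `ℓ¹` norm,
uniform in `v`, suffices.

The function `ramp ξ` lies between the indicator of `|s| ≥ 2ξ` and `|s| / ξ`. Hence `∑ |⟨b_i, v⟩| ≥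
ξ (N Q_{2ξ} - T)`, where `T` is the supremum over `u` of `∑ (𝔼 ramp ⟨b, u⟩ - ramp ⟨b_i, u⟩)`.
Changing one `b_i` changes `T` by at most one, so McDiarmid's inequality
(`hasSubgaussianMGF_of_bounded_differences`) gives `T ≤ 𝔼 T + t √N` outside an event of probability
at most `exp (-2t²)`. Because `ramp ξ` is `1/ξ`-Lipschitz, symmetrization and contraction
(`integral_iSup_sum_ramp_le`) yield `𝔼 T ≤ (2/ξ) √N W`. Dividing by `√N` gives the bound, with `N ≥
(m - 1) / 2`.

All suprema are taken over finite families, which settles measurability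
(`one_sub_exp_le_measure_finite`). The general case follows along a dense sequence in `E`, by
continuity of the measure from above and continuity of `v ↦ ‖A v‖`. -/

namespace SmallBall

/-! ### Product measures and the bounded differences inequality. -/

section Pi

theorem coe_piFinSuccAbove_symm {X : Type*} [MeasurableSpace X] {N : ℕ} :
    ⇑(MeasurableEquiv.piFinSuccAbove (fun _ : Fin (N + 1) => X) 0).symm =
      fun p : X × (Fin N → X) => (Fin.cons p.1 p.2 : Fin (N + 1) → X) := by
  funext p
  exact Fin.insertNth_zero' p.1 p.2

variable {X : Type*} [MeasurableSpace X] (ν : Measure X) [SigmaFinite ν] {N : ℕ}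

/-- Adding a coordinate in front identifies `ν ⊗ νᴺ` with `νᴺ⁺¹`. -/
theorem measurePreserving_cons :
    MeasurePreserving (fun p : X × (Fin N → X) => (Fin.cons p.1 p.2 : Fin (N + 1) → X))
      (ν.prod (Measure.pi fun _ => ν)) (Measure.pi fun _ => ν) := by
  have h := (measurePreserving_piFinSuccAbove (fun _ : Fin (N + 1) => ν) 0).symm
  convert h using 1
  exact coe_piFinSuccAbove_symm.symm

theorem measurableEmbedding_cons :
    MeasurableEmbedding (fun p : X × (Fin N → X) => (Fin.cons p.1 p.2 : Fin (N + 1) → X)) := by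
  have h := (MeasurableEquiv.piFinSuccAbove (fun _ : Fin (N + 1) => X) 0).symm.measurableEmbedding
  convert h using 1
  exact coe_piFinSuccAbove_symm.symm

theorem integral_pi_succ (f : (Fin (N + 1) → X) → ℝ) :
    ∫ x, f x ∂(Measure.pi fun _ => ν) =
      ∫ p : X × (Fin N → X), f (Fin.cons p.1 p.2) ∂(ν.prod (Measure.pi fun _ => ν)) :=
  ((measurePreserving_cons ν).integral_comp measurableEmbedding_cons f).symm

theorem integrable_pi_succ_iff {f : (Fin (N + 1) → X) → ℝ} :
    Integrable f (Measure.pi fun _ => ν) ↔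
      Integrable (fun p : X × (Fin N → X) => f (Fin.cons p.1 p.2))
        (ν.prod (Measure.pi fun _ => ν)) :=
  ((measurePreserving_cons ν).integrable_comp_emb measurableEmbedding_cons).symm

end Pi

/-- **McDiarmid's inequality**, in sub-Gaussian form: a bounded function of `N` independent
variables that changes by at most one when a single variable is changed is sub-Gaussian around its
mean, with variance proxy `N / 4`. -/
theorem hasSubgaussianMGF_of_bounded_differences {X : Type*} [MeasurableSpace X] (ν : Measure X)
    [IsProbabilityMeasure ν] (N : ℕ) (f : (Fin N → X) → ℝ) (hf : Measurable f) (C : ℝ)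
    (hC : ∀ x, |f x| ≤ C) (hd : ∀ x i y, |f (Function.update x i y) - f x| ≤ 1) :
    HasSubgaussianMGF (fun x => f x - ∫ y, f y ∂(Measure.pi fun _ => ν)) (N / 4)
      (Measure.pi fun _ => ν) := by
  have hint : ∀ {N : ℕ} (f : (Fin N → X) → ℝ), Measurable f → ∀ C : ℝ, (∀ x, |f x| ≤ C) →
      ∀ s c : ℝ, Integrable (fun x => Real.exp (s * (f x - c))) (Measure.pi fun _ => ν) := by
    intro N f hf C hC s c
    refine Integrable.of_bound (C := Real.exp (|s| * (C + |c|)))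
      (by fun_prop) (.of_forall fun x => ?_)
    rw [Real.norm_eq_abs, Real.abs_exp, Real.exp_le_exp]
    refine (le_abs_self _).trans ?_
    rw [abs_mul]
    gcongr
    exact (abs_sub _ _).trans (by gcongr; exact hC x)
  refine ⟨fun s => hint f hf C hC s _, fun s => ?_⟩
  -- Write `f - 𝔼 f = (f - g) + (g - 𝔼 g)`, where `g` averages out all coordinates but the first.
  -- Given the first coordinate, the former has proxy `N / 4` by induction; the latter contributes
  -- `1 / 4`.
  induction N generalizing C with
  | zero =>
    have h : ∀ x, f x = f default := fun x => congrArg f (Subsingleton.elim _ _)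
    simp [h, mgf]
  | succ N ih =>
    let P : Measure (Fin N → X) := Measure.pi fun _ => ν
    have hcons : Measurable fun p : X × (Fin N → X) => f (Fin.cons p.1 p.2) :=
      hf.comp measurableEmbedding_cons.measurable
    have hsec : ∀ x, Measurable fun y : Fin N → X => f (Fin.cons x y) := fun x =>
      hcons.comp measurable_prodMk_left
    have hseci : ∀ x, Integrable (fun y : Fin N → X => f (Fin.cons x y)) P := fun x =>
      Integrable.of_bound (hsec x).aestronglyMeasurable C (.of_forall fun y => hC _)
    let g : X → ℝ := fun x => ∫ y, f (Fin.cons x y) ∂P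
    have hg : Measurable g :=
      (hcons.stronglyMeasurable.integral_prod_right (ν := P)).measurable
    have hgC : ∀ x, |g x| ≤ C := fun x => by
      have := norm_integral_le_of_norm_le_const (μ := P) (f := fun y => f (Fin.cons x y))
        (.of_forall fun y => hC _)
      simpa using this
    have hfg : ∫ x, f x ∂(Measure.pi fun _ => ν) = ∫ x, g x ∂ν := by
      rw [integral_pi_succ, integral_prod]
      exact Integrable.of_bound hcons.aestronglyMeasurable C (.of_forall fun y => hC _)
    have hgd : ∀ x x', g x ≤ g x' + 1 := fun x x' => by
      have : ∫ y, f (Fin.cons x y) ∂P ≤ ∫ y, (f (Fin.cons x' y) + 1) ∂P := by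
        refine integral_mono (hseci x) ((hseci x').add (integrable_const _)) fun y => ?_
        have := hd (Fin.cons x' y) 0 x
        rw [Fin.update_cons_zero] at this
        linarith [le_abs_self (f (Fin.cons x y) - f (Fin.cons x' y))]
      rwa [integral_add (hseci x') (integrable_const _), integral_const, probReal_univ,
        one_smul] at this
    have : Nonempty X := nonempty_of_isProbabilityMeasure ν
    have hbdd : BddBelow (Set.range g) := ⟨-C, by
      rintro _ ⟨x, rfl⟩; exact (abs_le.1 (hgC x)).1⟩
    -- Hoeffding's lemma: `g` takes values in an interval of length one, whence the proxy `(1 /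
    -- 2)²`.
    have hoeff := (hasSubgaussianMGF_of_mem_Icc (μ := ν) (X := g) (a := ⨅ x, g x)
      (b := (⨅ x, g x) + 1) hg.aemeasurable (.of_forall fun x =>
        ⟨ciInf_le hbdd x, by
          have : g x - 1 ≤ ⨅ x, g x := le_ciInf fun x' => by linarith [hgd x x']
          linarith⟩)).mgf_le s
    have hinner : ∀ x, ∫ y, Real.exp (s * (f (Fin.cons x y) - g x)) ∂P ≤
        Real.exp ((N : ℝ) / 4 * s ^ 2 / 2) := fun x => by
      have := ih (fun y => f (Fin.cons x y)) (hsec x) C (fun y => hC _) fun y i z => by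
        have := hd (Fin.cons x y) i.succ z
        rwa [← Fin.cons_update] at this
      simpa [mgf] using this
    have hmg : mgf (fun x => f x - ∫ y, f y ∂(Measure.pi fun _ => ν)) (Measure.pi fun _ => ν) s =
        ∫ x, Real.exp (s * (g x - ∫ x, g x ∂ν)) *
          ∫ y, Real.exp (s * (f (Fin.cons x y) - g x)) ∂P ∂ν := by
      have hi := hint f hf C hC s (∫ x, g x ∂ν)
      rw [mgf, hfg, integral_pi_succ, integral_prod _ ((integrable_pi_succ_iff ν).1 hi)]
      refine integral_congr_ae (.of_forall fun x => ?_)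
      simp only
      rw [← integral_const_mul]
      refine integral_congr_ae (.of_forall fun y => ?_)
      simp only
      rw [← Real.exp_add]
      ring_nf
    rw [hmg]
    have hgi : Integrable (fun x => Real.exp (s * (g x - ∫ x, g x ∂ν))) ν := by
      refine Integrable.of_bound (C := Real.exp (|s| * (C + |∫ x, g x ∂ν|)))
        (by fun_prop) (.of_forall fun x => ?_)
      rw [Real.norm_eq_abs, Real.abs_exp, Real.exp_le_exp]
      refine (le_abs_self _).trans ?_
      rw [abs_mul]
      gcongr
      exact (abs_sub _ _).trans (by gcongr; exact hgC x)
    calc _ ≤ ∫ x, Real.exp (s * (g x - ∫ x, g x ∂ν)) * Real.exp ((N : ℝ) / 4 * s ^ 2 / 2) ∂ν := by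
          refine integral_mono_of_nonneg (.of_forall fun x => ?_) (hgi.mul_const _)
            (.of_forall fun x => ?_)
          · exact mul_nonneg (Real.exp_nonneg _) (integral_nonneg fun _ => Real.exp_nonneg _)
          · exact mul_le_mul_of_nonneg_left (hinner x) (Real.exp_nonneg _)
      _ ≤ Real.exp (1 / 4 * s ^ 2 / 2) * Real.exp ((N : ℝ) / 4 * s ^ 2 / 2) := by
          rw [integral_mul_const]
          gcongr
          refine hoeff.trans_eq ?_
          simp
          norm_num
      _ = _ := by
          rw [← Real.exp_add]
          push_cast
          ring_nf

/-! ### Expected maxima of finite processes. -/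

section FiniteSup

theorem le_iSup_of_finite {ι : Type*} [Finite ι] (c : ι → ℝ) (u : ι) : c u ≤ ⨆ v, c v :=
  le_ciSup (Set.finite_range c).bddAbove u

variable {ι : Type*} [Finite ι] [Nonempty ι]

theorem iSup_add_iSup_le_of_finite {c d : ι → ℝ} {r : ℝ} (h : ∀ u v, c u + d v ≤ r) :
    (⨆ u, c u) + ⨆ v, d v ≤ r := by
  obtain ⟨u, hu⟩ := exists_eq_ciSup_of_finite (f := c)
  obtain ⟨v, hv⟩ := exists_eq_ciSup_of_finite (f := d)
  rw [← hu, ← hv]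
  exact h u v

theorem integrable_iSup {Ω : Type*} [MeasurableSpace Ω] {μ : Measure Ω} {f : ι → Ω → ℝ}
    (hf : ∀ u, Integrable (f u) μ) : Integrable (fun ω => ⨆ u, f u ω) μ := by
  cases nonempty_fintype ι
  refine (integrable_finsetSum Finset.univ fun u _ => (hf u).norm).mono'
    (AEMeasurable.iSup fun u => (hf u).aemeasurable).aestronglyMeasurable (.of_forall fun ω => ?_)
  obtain ⟨u, hu⟩ := exists_eq_ciSup_of_finite (f := fun u => f u ω)
  rw [← hu]
  exact Finset.single_le_sum (f := fun u => ‖f u ω‖) (fun _ _ => norm_nonneg _) (Finset.mem_univ u)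

theorem iSup_integral_le {Ω : Type*} [MeasurableSpace Ω] {μ : Measure Ω} {f : ι → Ω → ℝ}
    (hf : ∀ u, Integrable (f u) μ) : ⨆ u, ∫ ω, f u ω ∂μ ≤ ∫ ω, ⨆ u, f u ω ∂μ :=
  ciSup_le fun u => integral_mono (hf u) (integrable_iSup hf) fun ω =>
    le_iSup_of_finite (fun u => f u ω) u

/-- If the expected maximum of `c + φ` is at most that of `c + g` for every shift `c`, then the
same comparison holds for sums of independent copies of the processes `φ` and `g`. -/
theorem integral_iSup_sum_le {X Y : Type*} [MeasurableSpace X] [MeasurableSpace Y]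
    (ν : Measure X) [IsProbabilityMeasure ν] (κ : Measure Y) [IsProbabilityMeasure κ]
    {φ : ι → X → ℝ} {g : ι → Y → ℝ} (hφ : ∀ u, Integrable (φ u) ν) (hg : ∀ u, Integrable (g u) κ)
    (h : ∀ c : ι → ℝ, ∫ x, ⨆ u, (c u + φ u x) ∂ν ≤ ∫ y, ⨆ u, (c u + g u y) ∂κ)
    (N : ℕ) (c : ι → ℝ) :
    ∫ x, ⨆ u, (c u + ∑ i, φ u (x i)) ∂(Measure.pi fun _ : Fin N => ν) ≤
      ∫ y, ⨆ u, (c u + ∑ i, g u (y i)) ∂(Measure.pi fun _ : Fin N => κ) := by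
  induction N generalizing c with
  | zero => simp
  | succ N ih =>
    have hφs : ∀ u, Integrable (fun x : Fin N → X => ∑ i, φ u (x i)) (Measure.pi fun _ => ν) :=
      fun u => integrable_finsetSum _ fun i _ => integrable_comp_eval (hφ u)
    have hgs : ∀ u, Integrable (fun y : Fin N → Y => ∑ i, g u (y i)) (Measure.pi fun _ => κ) :=
      fun u => integrable_finsetSum _ fun i _ => integrable_comp_eval (hg u)
    have hφp : Integrable (fun p : X × (Fin N → X) => ⨆ u, (c u + (φ u p.1 + ∑ i, φ u (p.2 i))))
        (ν.prod (Measure.pi fun _ => ν)) :=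
      integrable_iSup fun u => (integrable_const _).add
        (((hφ u).comp_fst _).add ((hφs u).comp_snd _))
    have hmp : Integrable (fun p : X × (Fin N → Y) => ⨆ u, (c u + (φ u p.1 + ∑ i, g u (p.2 i))))
        (ν.prod (Measure.pi fun _ => κ)) :=
      integrable_iSup fun u => (integrable_const _).add
        (((hφ u).comp_fst _).add ((hgs u).comp_snd _))
    have hgp : Integrable (fun p : Y × (Fin N → Y) => ⨆ u, (c u + (g u p.1 + ∑ i, g u (p.2 i))))
        (κ.prod (Measure.pi fun _ => κ)) :=
      integrable_iSup fun u => (integrable_const _).add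
        (((hg u).comp_fst _).add ((hgs u).comp_snd _))
    rw [integral_pi_succ, integral_pi_succ]
    simp only [Fin.sum_univ_succ, Fin.cons_zero, Fin.cons_succ]
    -- Replace the last `N` variables with `φ u x` absorbed into the shift, then exchange the
    -- integrals and replace the first variable with the other sum absorbed. This is why the
    -- comparison is required for every `c`.
    calc _ = ∫ x, ∫ x', ⨆ u, (c u + (φ u x + ∑ i, φ u (x' i)))
          ∂(Measure.pi fun _ : Fin N => ν) ∂ν := integral_prod _ hφp
      _ ≤ ∫ x, ∫ y', ⨆ u, (c u + (φ u x + ∑ i, g u (y' i)))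
          ∂(Measure.pi fun _ : Fin N => κ) ∂ν := by
        refine integral_mono hφp.integral_prod_left hmp.integral_prod_left fun x => ?_
        simpa only [add_assoc] using ih fun u => c u + φ u x
      _ = ∫ y', ∫ x, ⨆ u, (c u + (φ u x + ∑ i, g u (y' i)))
          ∂ν ∂(Measure.pi fun _ : Fin N => κ) := integral_integral_swap hmp
      _ ≤ ∫ y', ∫ y, ⨆ u, (c u + (g u y + ∑ i, g u (y' i)))
          ∂κ ∂(Measure.pi fun _ : Fin N => κ) := by
        refine integral_mono hmp.integral_prod_right hgp.integral_prod_right fun y' => ?_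
        have := h fun u => c u + ∑ i, g u (y' i)
        simpa only [add_assoc, add_comm (∑ i, g _ (y' i))] using this
      _ = _ := (integral_prod_symm _ hgp).symm

end FiniteSup

/-! ### Rademacher signs. -/

section Rademacher

instance : IsProbabilityMeasure rademacher := ⟨by
  simp [rademacher, ENNReal.inv_two_add_inv_two]⟩

theorem integral_rademacher (f : ℝ → ℝ) :
    ∫ s, f s ∂rademacher = 2⁻¹ * (f 1 + f (-1)) := by
  rw [rademacher, integral_add_measure, integral_smul_measure, integral_smul_measure,
    integral_dirac, integral_dirac]
  · simp; ring
  · exact (integrable_dirac (by simp)).smul_measure (by simp)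
  · exact (integrable_dirac (by simp)).smul_measure (by simp)

theorem measurePreserving_neg_rademacher :
    MeasurePreserving (fun s : ℝ => -s) rademacher rademacher := by
  refine ⟨measurable_neg, ?_⟩
  rw [rademacher, Measure.map_add _ _ measurable_neg, Measure.map_smul, Measure.map_smul,
    Measure.map_dirac' measurable_neg, Measure.map_dirac' measurable_neg, neg_neg, add_comm]

end Rademacher

/-! ### The Lipschitz substitute for the indicator. -/

section Ramp

/-- The piecewise linear function that vanishes for `|s| ≤ ξ` and equals one for `|s| ≥ 2 ξ`. -/
noncomputable def ramp (ξ s : ℝ) : ℝ := max 0 (min 1 (|s| / ξ - 1))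

variable {ξ : ℝ}

theorem ramp_nonneg (s : ℝ) : 0 ≤ ramp ξ s := le_max_left _ _

theorem ramp_le_one (s : ℝ) : ramp ξ s ≤ 1 := max_le zero_le_one (min_le_left _ _)

theorem abs_ramp_le_one (s : ℝ) : |ramp ξ s| ≤ 1 :=
  abs_le.2 ⟨by linarith [ramp_nonneg (ξ := ξ) s], ramp_le_one s⟩

theorem mul_ramp_le_abs (hξ : 0 < ξ) (s : ℝ) : ξ * ramp ξ s ≤ |s| := by
  have : ramp ξ s ≤ |s| / ξ := max_le (by positivity) ((min_le_right _ _).trans (by linarith))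
  rwa [le_div_iff₀' hξ] at this

theorem ramp_eq_one (hξ : 0 < ξ) {s : ℝ} (hs : 2 * ξ ≤ |s|) : ramp ξ s = 1 := by
  have : 2 ≤ |s| / ξ := by rwa [le_div_iff₀ hξ]
  rw [ramp, min_eq_left (by linarith), max_eq_right zero_le_one]

/-- The map `|s| / ξ` is `1/ξ`-Lipschitz, and truncation to `[0, 1]` does not increase differences.
-/
theorem ramp_sub_ramp_le (hξ : 0 < ξ) (s r : ℝ) : ramp ξ s - ramp ξ r ≤ |s - r| / ξ := by
  have h1 : |s| / ξ ≤ |r| / ξ + |s - r| / ξ := by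
    rw [← add_div]
    gcongr
    linarith [abs_sub_abs_le_abs_sub s r]
  have h2 : 0 ≤ |s - r| / ξ := by positivity
  unfold ramp
  rcases max_cases 0 (min 1 (|s| / ξ - 1)) with h | h <;>
  rcases max_cases 0 (min 1 (|r| / ξ - 1)) with h' | h' <;>
  rcases min_cases 1 (|s| / ξ - 1) with h'' | h'' <;>
  rcases min_cases 1 (|r| / ξ - 1) with h''' | h''' <;> linarith

theorem measurable_ramp : Measurable (ramp ξ) := by
  unfold ramp
  fun_prop

end Ramp

/-! ### Symmetrization and contraction. -/

section Symmetrization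

variable {ι : Type*} [Finite ι] [Nonempty ι] {X : Type*} [MeasurableSpace X] (ν : Measure X)
  [IsProbabilityMeasure ν]

theorem integral_prod_rademacher {F : X × ℝ → ℝ} (hF : Integrable F (ν.prod rademacher)) :
    ∫ p, F p ∂(ν.prod rademacher) = ∫ x, 2⁻¹ * (F (x, 1) + F (x, -1)) ∂ν := by
  rw [integral_prod _ hF]
  simp only [integral_rademacher]

/-- Symmetrization of a single summand. -/
theorem integral_iSup_centered_le {φ : ι → X → ℝ} (hφ : ∀ u, Integrable (φ u) ν) (c : ι → ℝ) :
    ∫ x, ⨆ u, (c u + (∫ y, φ u y ∂ν - φ u x)) ∂ν ≤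
      ∫ x, 2⁻¹ * ((⨆ u, (c u + 2 * φ u x)) + ⨆ u, (c u - 2 * φ u x)) ∂ν := by
  have hplus : Integrable (fun x => ⨆ u, (c u + 2 * φ u x)) ν :=
    integrable_iSup fun u => (integrable_const _).add ((hφ u).const_mul 2)
  have hminus : Integrable (fun x => ⨆ u, (c u - 2 * φ u x)) ν :=
    integrable_iSup fun u => (integrable_const _).sub ((hφ u).const_mul 2)
  have hpair : ∀ x u, Integrable (fun y => c u + (φ u y - φ u x)) ν := fun x u =>
    (integrable_const _).add ((hφ u).sub (integrable_const _))
  -- The summand is the average of `c u + 2 φ u y` and `c u - 2 φ u x`, so the two suprema decouple.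
  -- This is the source of the factor 2 in front of `W`.
  have hle : ∀ x y, ⨆ u, (c u + (φ u y - φ u x)) ≤
      2⁻¹ * ((⨆ u, (c u + 2 * φ u y)) + ⨆ u, (c u - 2 * φ u x)) := fun x y =>
    ciSup_le fun u => by
      have h1 := le_iSup_of_finite (fun u => c u + 2 * φ u y) u
      have h2 := le_iSup_of_finite (fun u => c u - 2 * φ u x) u
      linarith
  calc _ ≤ ∫ x, 2⁻¹ * ((∫ y, ⨆ u, (c u + 2 * φ u y) ∂ν) + ⨆ u, (c u - 2 * φ u x)) ∂ν := by
        refine integral_mono (integrable_iSup fun u => (integrable_const _).add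
          ((integrable_const _).sub (hφ u))) (((integrable_const _).add hminus).const_mul _)
          fun x => ?_
        calc ⨆ u, (c u + (∫ y, φ u y ∂ν - φ u x))
            = ⨆ u, ∫ y, (c u + (φ u y - φ u x)) ∂ν := by
              congr 1 with u
              have hs : Integrable (fun y => φ u y - φ u x) ν := (hφ u).sub (integrable_const _)
              rw [integral_add (integrable_const _) hs, integral_sub (hφ u) (integrable_const _)]
              simp
          _ ≤ ∫ y, ⨆ u, (c u + (φ u y - φ u x)) ∂ν := iSup_integral_le (hpair x)
          _ ≤ ∫ y, 2⁻¹ * ((⨆ u, (c u + 2 * φ u y)) + ⨆ u, (c u - 2 * φ u x)) ∂ν :=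
              integral_mono (integrable_iSup (hpair x))
                ((hplus.add (integrable_const _)).const_mul _) (hle x)
          _ = _ := by
              rw [integral_const_mul, integral_add hplus (integrable_const _)]
              simp
    _ = _ := by
        rw [integral_const_mul, integral_const_mul, integral_add (integrable_const _) hminus,
          integral_add hplus hminus]
        simp

/-- The contraction principle for a single Rademacher sign. -/
theorem iSup_ramp_add_iSup_ramp_le {ξ : ℝ} (hξ : 0 < ξ) (c r : ι → ℝ) :
    (⨆ u, (c u + 2 * ramp ξ (r u))) + (⨆ u, (c u - 2 * ramp ξ (r u))) ≤
      (⨆ u, (c u + 2 / ξ * r u)) + ⨆ u, (c u - 2 / ξ * r u) := by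
  refine iSup_add_iSup_le_of_finite fun u v => ?_
  have h := ramp_sub_ramp_le hξ (r u) (r v)
  have h1 := fun u => le_iSup_of_finite (fun u => c u + 2 / ξ * r u) u
  have h2 := fun u => le_iSup_of_finite (fun u => c u - 2 / ξ * r u) u
  have e : 2 / ξ * r u - 2 / ξ * r v = 2 * ((r u - r v) / ξ) := by ring
  -- If `r u < r v`, the bound is obtained with the roles of `u` and `v` exchanged on the right-hand
  -- side.
  rcases abs_cases (r u - r v) with ⟨ha, -⟩ | ⟨ha, -⟩
  · rw [ha] at h
    linarith [h1 u, h2 v]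
  · rw [ha, neg_div] at h
    linarith [h1 v, h2 u]

/-- Symmetrization and contraction: the expected maximum of the centered process of ramps is
bounded by the Rademacher process. -/
theorem integral_iSup_sum_ramp_le {ξ : ℝ} (hξ : 0 < ξ) {f : ι → X → ℝ}
    (hf : ∀ u, Measurable (f u))
    (hfi : ∀ u, Integrable (fun p : X × ℝ => p.2 * f u p.1) (ν.prod rademacher)) (N : ℕ) :
    ∫ x, ⨆ u, ∑ i, (∫ y, ramp ξ (f u y) ∂ν - ramp ξ (f u (x i)))
        ∂(Measure.pi fun _ : Fin N => ν) ≤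
      2 / ξ * ∫ p, ⨆ u, ∑ i, (p i).2 * f u (p i).1
        ∂(Measure.pi fun _ : Fin N => ν.prod rademacher) := by
  have hr : ∀ u, Integrable (fun x => ramp ξ (f u x)) ν := fun u =>
    Integrable.of_bound (measurable_ramp.comp (hf u)).aestronglyMeasurable 1
      (.of_forall fun x => abs_ramp_le_one _)
  have hmain := integral_iSup_sum_le ν (ν.prod rademacher)
    (φ := fun u x => ∫ y, ramp ξ (f u y) ∂ν - ramp ξ (f u x))
    (g := fun u p => 2 / ξ * (p.2 * f u p.1))
    (fun u => (integrable_const _).sub (hr u)) (fun u => (hfi u).const_mul _)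
    (fun c => by
      have hi : Integrable (fun p : X × ℝ => ⨆ u, (c u + 2 / ξ * (p.2 * f u p.1)))
          (ν.prod rademacher) :=
        integrable_iSup fun u => (integrable_const _).add ((hfi u).const_mul _)
      -- Averaging `|s * f u x|` over the sign `s` returns `|f u x|`.
      have hfu : ∀ u, Integrable (f u) ν := fun u => by
        have h := (hfi u).norm.integral_prod_left
        simp only [norm_mul, integral_rademacher] at h
        refine h.mono' (hf u).aestronglyMeasurable (.of_forall fun x => ?_)
        norm_num
        linarith
      refine (integral_iSup_centered_le ν hr c).trans ?_
      rw [integral_prod_rademacher ν hi]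
      refine integral_mono ?_ ?_ fun x => ?_
      · exact ((integrable_iSup fun u => (integrable_const _).add ((hr u).const_mul 2)).add
          (integrable_iSup fun u => (integrable_const _).sub ((hr u).const_mul 2))).const_mul _
      · exact ((integrable_iSup fun u => (integrable_const _).add
          (((hfu u).const_mul 1).const_mul (2 / ξ))).add
          (integrable_iSup fun u => (integrable_const _).add
            (((hfu u).const_mul (-1)).const_mul (2 / ξ)))).const_mul _
      · have := iSup_ramp_add_iSup_ramp_le hξ c fun u => f u x
        simp only [one_mul, neg_mul, mul_neg, ← sub_eq_add_neg]
        gcongr) N 0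
  simp only [Pi.zero_apply, zero_add, ← Finset.mul_sum] at hmain
  refine hmain.trans_eq ?_
  rw [← integral_const_mul]
  congr 1 with p
  exact (Real.mul_iSup_of_nonneg (by positivity) _).symm

end Symmetrization

/-! ### The small ball estimate for finite families. -/

section FiniteFamily

variable {ι : Type*} [Finite ι] [Nonempty ι] {X : Type*}

/-- Replacing one variable changes the maximum of a process of sums of ramps by at most one. -/
theorem iSup_sum_ramp_update_le (ξ : ℝ) (c : ι → ℝ) (f : ι → X → ℝ) {N : ℕ} (x : Fin N → X)
    (i : Fin N) (y : X) :
    ⨆ u, ∑ j, (c u - ramp ξ (f u (Function.update x i y j))) ≤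
      (⨆ u, ∑ j, (c u - ramp ξ (f u (x j)))) + 1 := by
  refine ciSup_le fun u => ?_
  have h := le_iSup_of_finite (fun u => ∑ j, (c u - ramp ξ (f u (x j)))) u
  have hs : ∑ j, (c u - ramp ξ (f u (Function.update x i y j))) -
      ∑ j, (c u - ramp ξ (f u (x j))) = ramp ξ (f u (x i)) - ramp ξ (f u y) := by
    rw [← Finset.sum_sub_distrib, Finset.sum_eq_single i]
    · simp
    · intro j _ hj
      simp [Function.update_of_ne hj]
    · simp
  linarith [ramp_le_one (ξ := ξ) (f u (x i)), ramp_nonneg (ξ := ξ) (f u y)]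

variable [MeasurableSpace X] (ν : Measure X) [IsProbabilityMeasure ν]

/-- The small ball method for a finite family of functions on a probability space. -/
theorem one_sub_exp_le_measure_finite {f : ι → X → ℝ} (hf : ∀ u, Measurable (f u))
    (hfi : ∀ u, Integrable (fun p : X × ℝ => p.2 * f u p.1) (ν.prod rademacher))
    {N : ℕ} (hN : 0 < N) {ξ t q w : ℝ} (hξ : 0 < ξ) (ht : 0 < t)
    (hq : ∀ u, q ≤ ν.real {x | 2 * ξ ≤ |f u x|})
    (hw : ∫ p, ⨆ u, ∑ i, (p i).2 * f u (p i).1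
        ∂(Measure.pi fun _ : Fin N => ν.prod rademacher) ≤ √(N : ℝ) * w) :
    1 - Real.exp (-2 * t ^ 2) ≤ (Measure.pi fun _ : Fin N => ν).real
      {x | ∀ u, ξ * √(N : ℝ) * q - ξ * t - 2 * w ≤ (√(N : ℝ))⁻¹ * ∑ i, |f u (x i)|} := by
  set P : Measure (Fin N → X) := Measure.pi fun _ : Fin N => ν with hP
  have hN' : (0 : ℝ) < N := by exact_mod_cast hN
  have hsN : 0 < √(N : ℝ) := Real.sqrt_pos.2 hN'
  have hr : ∀ u, Integrable (fun x => ramp ξ (f u x)) ν := fun u =>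
    Integrable.of_bound (measurable_ramp.comp (hf u)).aestronglyMeasurable 1
      (.of_forall fun x => abs_ramp_le_one _)
  let e : ι → ℝ := fun u => ∫ y, ramp ξ (f u y) ∂ν
  have hqe : ∀ u, q ≤ e u := fun u => (hq u).trans <| by
    have hm : MeasurableSet {x | 2 * ξ ≤ |f u x|} := measurableSet_le measurable_const (hf u).abs
    rw [← integral_indicator_one hm]
    refine integral_mono ((integrable_const (1 : ℝ)).indicator hm) (hr u) fun x => ?_
    by_cases hx : 2 * ξ ≤ |f u x|
    · simp [Set.indicator, hx, ramp_eq_one hξ hx]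
    · simp [Set.indicator, hx, ramp_nonneg]
  have he0 : ∀ u, 0 ≤ e u := fun u => integral_nonneg fun _ => ramp_nonneg _
  have he1 : ∀ u, e u ≤ 1 := fun u => by
    have := integral_mono (hr u) (integrable_const (1 : ℝ)) fun x => ramp_le_one _
    simpa using this
  let T : (Fin N → X) → ℝ := fun x => ⨆ u, ∑ i, (e u - ramp ξ (f u (x i)))
  have hT : Measurable T := Measurable.iSup fun u => Finset.measurable_fun_sum _ fun i _ =>
    measurable_const.sub (measurable_ramp.comp ((hf u).comp (measurable_pi_apply i)))
  have hTb : ∀ x, |T x| ≤ N := fun x => by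
    obtain ⟨u, hu⟩ := exists_eq_ciSup_of_finite (f := fun u => ∑ i, (e u - ramp ξ (f u (x i))))
    change |⨆ u, ∑ i, (e u - ramp ξ (f u (x i)))| ≤ N
    rw [← hu]
    refine (Finset.abs_sum_le_sum_abs _ _).trans ?_
    refine (Finset.sum_le_card_nsmul _ _ 1 fun i _ => abs_le.2 ⟨?_, ?_⟩).trans_eq (by simp)
    · linarith [he0 u, ramp_le_one (ξ := ξ) (f u (x i))]
    · linarith [he1 u, ramp_nonneg (ξ := ξ) (f u (x i))]
  have hTd : ∀ x i y, |T (Function.update x i y) - T x| ≤ 1 := fun x i y => by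
    have h1 := iSup_sum_ramp_update_le ξ e f x i y
    have h2 := iSup_sum_ramp_update_le ξ e f (Function.update x i y) i (x i)
    rw [Function.update_idem, Function.update_eq_self] at h2
    change T (Function.update x i y) ≤ T x + 1 at h1
    change T x ≤ T (Function.update x i y) + 1 at h2
    exact abs_le.2 ⟨by linarith, by linarith⟩
  have htail := (hasSubgaussianMGF_of_bounded_differences ν N T hT N hTb hTd).measure_ge_le
    (ε := t * √(N : ℝ)) (by positivity)
  -- Deviation `t √N` against variance proxy `N / 4` leaves an exponent free of `N`.
  have hexp : -(t * √(N : ℝ)) ^ 2 / (2 * ((N / 4 : NNReal) : ℝ)) = -2 * t ^ 2 := by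
    rw [mul_pow, Real.sq_sqrt hN'.le]
    push_cast
    field_simp
    norm_num
  rw [hexp] at htail
  have hET : ∫ x, T x ∂P ≤ 2 / ξ * (√(N : ℝ) * w) :=
    (integral_iSup_sum_ramp_le ν hξ hf hfi N).trans (by gcongr)
  have hS : MeasurableSet {x | t * √(N : ℝ) ≤ T x - ∫ y, T y ∂P} :=
    measurableSet_le measurable_const (hT.sub_const _)
  calc 1 - Real.exp (-2 * t ^ 2) ≤ 1 - P.real {x | t * √(N : ℝ) ≤ T x - ∫ y, T y ∂P} := by
        linarith
    _ = P.real {x | t * √(N : ℝ) ≤ T x - ∫ y, T y ∂P}ᶜ := (probReal_compl_eq_one_sub hS).symm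
    _ ≤ _ := by
        refine measureReal_mono fun x hx u => ?_
        simp only [Set.mem_compl_iff, Set.mem_ofPred_eq, not_le] at hx
        have h1 : N * e u - ∑ i, ramp ξ (f u (x i)) ≤ T x := by
          have : ∑ i, (e u - ramp ξ (f u (x i))) ≤ T x :=
            le_iSup_of_finite (fun u => ∑ i, (e u - ramp ξ (f u (x i)))) u
          rwa [Finset.sum_sub_distrib, Finset.sum_const, Finset.card_univ, Fintype.card_fin,
            nsmul_eq_mul] at this
        have h2 : ξ * ∑ i, ramp ξ (f u (x i)) ≤ ∑ i, |f u (x i)| := by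
          rw [Finset.mul_sum]
          exact Finset.sum_le_sum fun i _ => mul_ramp_le_abs hξ _
        have h3 : (N : ℝ) * q ≤ N * e u := by gcongr; exact hqe u
        have h4 : ξ * (N * q - (t * √(N : ℝ) + 2 / ξ * (√(N : ℝ) * w))) ≤ ∑ i, |f u (x i)| :=
          (mul_le_mul_of_nonneg_left (by linarith) hξ.le).trans h2
        rw [← div_eq_inv_mul, le_div_iff₀ hsN]
        refine le_trans (le_of_eq ?_) h4
        have hss := Real.mul_self_sqrt hN'.le
        field_simp
        linear_combination (ξ * q) * hss

end FiniteFamily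

/-! ### Extended expectations and integrability. -/

section Expectation

variable {Ω : Type*} [MeasurableSpace Ω] {μ : Measure Ω}

/-- Only monotonicity of the lower integral is used, so `S`, later a supremum over a possibly
uncountable set, need not be measurable. -/
theorem coe_integral_le_expectation {M : Ω → ℝ} {S : Ω → EReal} (hM : Integrable M μ)
    (h : ∀ ω, (M ω : EReal) ≤ S ω) : ((∫ ω, M ω ∂μ : ℝ) : EReal) ≤ expectation μ S := by
  have h1 : ∫⁻ ω, ENNReal.ofReal (M ω) ∂μ ≠ ∞ := hM.lintegral_lt_top.ne
  have h2 : ∫⁻ ω, ENNReal.ofReal (-M ω) ∂μ ≠ ∞ := hM.neg.lintegral_lt_top.ne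
  rw [integral_eq_lintegral_pos_part_sub_lintegral_neg_part hM, EReal.coe_sub,
    EReal.coe_ennreal_toReal h1, EReal.coe_ennreal_toReal h2]
  refine EReal.sub_le_sub ?_ ?_
  · exact EReal.coe_ennreal_le_coe_ennreal_iff.2
      (lintegral_mono fun ω => EReal.toENNReal_le_toENNReal (h ω))
  · exact EReal.coe_ennreal_le_coe_ennreal_iff.2
      (lintegral_mono fun ω => EReal.toENNReal_le_toENNReal (EReal.neg_le_neg_iff.2 (h ω)))

theorem integrable_of_lintegral_ofReal_ne_top {M : Ω → ℝ} (hM : AEMeasurable M μ)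
    (h1 : ∫⁻ ω, ENNReal.ofReal (M ω) ∂μ ≠ ∞) (h2 : ∫⁻ ω, ENNReal.ofReal (-M ω) ∂μ ≠ ∞) :
    Integrable M μ := by
  refine ⟨hM.aestronglyMeasurable, ?_⟩
  refine (lintegral_mono fun ω => ?_).trans_lt
    ((lintegral_add_left' hM.ennreal_ofReal _).trans_lt (ENNReal.add_lt_top.2
      ⟨h1.lt_top, h2.lt_top⟩))
  rw [Real.enorm_eq_ofReal_abs]
  rcases abs_cases (M ω) with ⟨h, -⟩ | ⟨h, -⟩ <;> rw [h]
  · exact le_self_add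
  · exact le_add_self

end Expectation

/-- A function is integrable if the sum of its copies in independent variables is. -/
theorem integrable_of_integrable_sum {X : Type*} [MeasurableSpace X] (κ : Measure X)
    [IsProbabilityMeasure κ] {N : ℕ} (hN : 0 < N) {g : X → ℝ}
    (hg : Integrable (fun x : Fin N → X => ∑ i, g (x i)) (Measure.pi fun _ => κ)) :
    Integrable g κ := by
  obtain ⟨N, rfl⟩ := Nat.exists_eq_succ_of_ne_zero hN.ne'
  have h := (integrable_pi_succ_iff κ).1 hg
  simp only [Fin.sum_univ_succ, Fin.cons_zero, Fin.cons_succ] at h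
  -- By Fubini, almost every section with the other variables frozen is integrable, and along it
  -- their sum is a constant.
  obtain ⟨y, hy⟩ := h.prod_left_ae.exists
  exact (hy.sub (integrable_const (∑ i, g (y i)))).congr (.of_forall fun x => by simp)

/-- The sign symmetry of the Rademacher process: it is integrable if its positive part is. -/
theorem integrable_rademacher_of_lintegral {X : Type*} [MeasurableSpace X] (ν : Measure X)
    [IsProbabilityMeasure ν] {f : X → ℝ} (hf : Measurable f) {N : ℕ} (hN : 0 < N)
    (h : ∫⁻ p, ENNReal.ofReal (∑ i, (p i).2 * f (p i).1)
      ∂(Measure.pi fun _ : Fin N => ν.prod rademacher) ≠ ∞) :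
    Integrable (fun p : X × ℝ => p.2 * f p.1) (ν.prod rademacher) := by
  have hmeas : Measurable fun p : Fin N → X × ℝ => ∑ i, (p i).2 * f (p i).1 := by fun_prop
  refine integrable_of_integrable_sum _ hN
    (integrable_of_lintegral_ofReal_ne_top hmeas.aemeasurable h ?_)
  -- Flipping all signs preserves the law and exchanges the positive and negative parts of the sum.
  have hneg := measurePreserving_pi (fun _ : Fin N => ν.prod rademacher)
    (fun _ : Fin N => ν.prod rademacher)
    fun _ => (MeasurePreserving.id ν).prod measurePreserving_neg_rademacher
  rw [← hneg.lintegral_comp hmeas.ennreal_ofReal] at h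
  simpa using h

/-! ### The law of the debiased rows and the signs. -/

section Law

theorem map_prodMap_of_aemeasurable {α β γ δ : Type*} [MeasurableSpace α] [MeasurableSpace β]
    [MeasurableSpace γ] [MeasurableSpace δ] {μ : Measure α} {ν : Measure γ} [SFinite μ] [SFinite ν]
    {f : α → β} {g : γ → δ} (hf : AEMeasurable f μ) (hg : AEMeasurable g ν) :
    AEMeasurable (Prod.map f g) (μ.prod ν) ∧
      (μ.prod ν).map (Prod.map f g) = (μ.map f).prod (ν.map g) := by
  have hae : Prod.map f g =ᵐ[μ.prod ν] Prod.map (hf.mk f) (hg.mk g) := by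
    filter_upwards [Measure.quasiMeasurePreserving_fst.ae hf.ae_eq_mk,
      Measure.quasiMeasurePreserving_snd.ae hg.ae_eq_mk] with p h1 h2
    exact Prod.ext h1 h2
  refine ⟨⟨_, hf.measurable_mk.prodMap hg.measurable_mk, hae⟩, ?_⟩
  rw [Measure.map_congr hae, ← Measure.map_prod_map _ _ hf.measurable_mk hg.measurable_mk,
    ← Measure.map_congr hf.ae_eq_mk, ← Measure.map_congr hg.ae_eq_mk]

theorem row_debias {m n : ℕ} (A : Matrix (Fin m) (Fin n) ℝ) (i : Fin (m / 2)) :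
    row (debias A) i =
      (√2)⁻¹ • (row A ⟨2 * i.1, by omega⟩ - row A ⟨2 * i.1 + 1, by omega⟩) := by
  ext j
  simp [row, debias, div_eq_inv_mul]

/-- The embedding of two copies of the indices `0 ≤ i < ⌊m/2⌋` as the even and the odd rows. -/
def pairIndex (m : ℕ) : Fin (m / 2) ⊕ Fin (m / 2) → Fin m :=
  Sum.elim (fun i => ⟨2 * i.1, by omega⟩) (fun i => ⟨2 * i.1 + 1, by omega⟩)

theorem pairIndex_injective (m : ℕ) : Function.Injective (pairIndex m) := by
  rintro (i | i) (j | j) h <;> simp only [pairIndex, Sum.elim_inl, Sum.elim_inr, Fin.mk.injEq] at h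
  · exact congrArg Sum.inl (Fin.ext (by omega))
  · omega
  · omega
  · exact congrArg Sum.inr (Fin.ext (by omega))

variable {Ω Ω₀ : Type*} [MeasurableSpace Ω] [MeasurableSpace Ω₀]
    {μ : Measure Ω} {μ₀ : Measure Ω₀} [IsProbabilityMeasure μ₀]
    {m n : ℕ} {a : Ω₀ → EuclideanSpace ℝ (Fin n)} {A : Ω → Matrix (Fin m) (Fin n) ℝ}

theorem aemeasurable_row_debias (hA : ∀ i, AEMeasurable (fun ω => row (A ω) i) μ) :
    AEMeasurable (fun ω i => row (debias (A ω)) i) μ := by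
  refine aemeasurable_pi_lambda _ fun i => ?_
  simp only [row_debias]
  exact ((hA _).sub (hA _)).const_smul (√2)⁻¹

theorem map_debiasedVector (ha : AEMeasurable a μ₀) :
    AEMeasurable (debiasedVector a) (μ₀.prod μ₀) ∧ (μ₀.prod μ₀).map (debiasedVector a) =
      ((μ₀.map a).prod (μ₀.map a)).map fun p => (√2)⁻¹ • (p.1 - p.2) := by
  obtain ⟨h1, h2⟩ := map_prodMap_of_aemeasurable ha ha
  have hd : Measurable fun p : EuclideanSpace ℝ (Fin n) × EuclideanSpace ℝ (Fin n) =>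
    (√2)⁻¹ • (p.1 - p.2) := by fun_prop
  refine ⟨hd.comp_aemeasurable h1, ?_⟩
  rw [← h2, AEMeasurable.map_map_of_aemeasurable hd.aemeasurable h1]
  rfl

/-- The rows of the debiased matrix are independent copies of the debiased vector. -/
theorem map_row_debias (hindep : iIndepFun (fun i ω => row (A ω) i) μ)
    (hcopies : ∀ i, IdentDistrib (fun ω => row (A ω) i) a μ μ₀) (ha : AEMeasurable a μ₀) :
    μ.map (fun ω i => row (debias (A ω)) i) =
      Measure.pi fun _ => (μ₀.prod μ₀).map (debiasedVector a) := by
  have : IsProbabilityMeasure (μ₀.map a) := Measure.isProbabilityMeasure_map ha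
  have hA : ∀ i, AEMeasurable (fun ω => row (A ω) i) μ := fun i => (hcopies i).aemeasurable_fst
  have hpairs := (hindep.precomp (pairIndex_injective m)).map_fun_eq_pi_map fun s => hA _
  simp only [fun i => (hcopies i).map_eq] at hpairs
  have hd : Measurable fun p : EuclideanSpace ℝ (Fin n) × EuclideanSpace ℝ (Fin n) =>
    (√2)⁻¹ • (p.1 - p.2) := by fun_prop
  have : IsProbabilityMeasure (((μ₀.map a).prod (μ₀.map a)).map
    fun p => (√2)⁻¹ • (p.1 - p.2)) := Measure.isProbabilityMeasure_map hd.aemeasurable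
  -- Regroup the `2 ⌊m/2⌋` independent rows into independent pairs, then take the scaled difference
  -- within each pair.
  have hT := (measurePreserving_pi (fun _ : Fin (m / 2) => (μ₀.map a).prod (μ₀.map a)) _
      fun _ => hd.measurePreserving _).comp
    ((measurePreserving_arrowProdEquivProdArrow _ _ (Fin (m / 2)) (fun _ => μ₀.map a)
      (fun _ => μ₀.map a)).symm.comp
    (measurePreserving_sumPiEquivProdPi fun _ : Fin (m / 2) ⊕ Fin (m / 2) => μ₀.map a))
  rw [(map_debiasedVector ha).2, ← hT.map_eq, ← hpairs,
    AEMeasurable.map_map_of_aemeasurable hT.measurable.aemeasurable (aemeasurable_pi_lambda _ fun s => hA _)]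
  congr 1
  funext ω i
  exact row_debias (A ω) i

/-- The joint law of independent vectors and an independent Rademacher sequence. -/
theorem map_prod_rademacherSeq [IsProbabilityMeasure μ] {X : Type*} [MeasurableSpace X] {ν : Measure X}
    [IsProbabilityMeasure ν] {N : ℕ} {b : Ω → Fin N → X} (hb : AEMeasurable b μ)
    (hlaw : μ.map b = Measure.pi fun _ => ν) :
    AEMeasurable (fun (p : Ω × (Fin N → ℝ)) i => (b p.1 i, p.2 i)) (μ.prod (rademacherSeq N)) ∧
      (μ.prod (rademacherSeq N)).map (fun p i => (b p.1 i, p.2 i)) =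
        Measure.pi fun _ => ν.prod rademacher := by
  have : IsProbabilityMeasure (rademacherSeq N) := by unfold rademacherSeq; infer_instance
  obtain ⟨h1, h2⟩ := map_prodMap_of_aemeasurable hb (aemeasurable_id (μ := rademacherSeq N))
  have he := (measurePreserving_arrowProdEquivProdArrow X ℝ (Fin N) (fun _ => ν)
      (fun _ => rademacher)).symm
  refine ⟨he.measurable.comp_aemeasurable h1, ?_⟩
  rw [Measure.map_id, hlaw] at h2
  rw [← he.map_eq]
  change _ = Measure.map _ ((Measure.pi fun _ => ν).prod (rademacherSeq N))
  rw [← h2, AEMeasurable.map_map_of_aemeasurable he.measurable.aemeasurable h1]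
  rfl

end Law

/-! ### Deterministic comparison of `‖A v‖` with the debiased rows. -/

section Norm

theorem toEuclideanLin_apply_eq_inner_row {m n : ℕ} (A : Matrix (Fin m) (Fin n) ℝ)
    (v : EuclideanSpace ℝ (Fin n)) (i : Fin m) :
    Matrix.toEuclideanLin A v i = inner ℝ (row A i) v := by
  simp [Matrix.toLpLin_apply, Matrix.mulVec, dotProduct, row, PiLp.inner_apply, mul_comm]

/-- Debiasing and passing from the `ℓ²` to the `ℓ¹` norm only decrease `‖A v‖`. -/
theorem inv_sqrt_mul_sum_abs_inner_le_norm {m n : ℕ} (A : Matrix (Fin m) (Fin n) ℝ)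
    (v : EuclideanSpace ℝ (Fin n)) :
    (√((m / 2 : ℕ) : ℝ))⁻¹ * ∑ i, |inner ℝ (row (debias A) i) v| ≤
      ‖Matrix.toEuclideanLin A v‖ := by
  have hsq : ∑ i, |inner ℝ (row (debias A) i) v| ^ 2 ≤ ‖Matrix.toEuclideanLin A v‖ ^ 2 := by
    rw [EuclideanSpace.norm_sq_eq]
    simp only [toEuclideanLin_apply_eq_inner_row, Real.norm_eq_abs, sq_abs]
    calc _ ≤ ∑ i, ((inner ℝ (row A (pairIndex m (.inl i))) v) ^ 2 +
          (inner ℝ (row A (pairIndex m (.inr i))) v) ^ 2) := by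
          refine Finset.sum_le_sum fun i _ => ?_
          have h2 : ((√2)⁻¹ : ℝ) ^ 2 = 2⁻¹ := by rw [inv_pow, Real.sq_sqrt (by norm_num)]
          rw [row_debias, real_inner_smul_left, mul_pow, h2, inner_sub_left]
          change 2⁻¹ * (inner ℝ (row A (pairIndex m (.inl i))) v -
            inner ℝ (row A (pairIndex m (.inr i))) v) ^ 2 ≤ _
          -- The defect in `(x - y)² / 2 ≤ x² + y²` is `(x + y)² / 2`.
          nlinarith [sq_nonneg (inner ℝ (row A (pairIndex m (.inl i))) v +
            inner ℝ (row A (pairIndex m (.inr i))) v)]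
      _ = ∑ s, (inner ℝ (row A (pairIndex m s)) v) ^ 2 := by
          rw [Fintype.sum_sum_type, Finset.sum_add_distrib]
      _ = ∑ j ∈ Finset.univ.map ⟨pairIndex m, pairIndex_injective m⟩,
          (inner ℝ (row A j) v) ^ 2 := by
          rw [Finset.sum_map]
          rfl
      -- For odd `m` the unpaired last row is dropped.
      _ ≤ _ := Finset.sum_le_sum_of_subset_of_nonneg (Finset.subset_univ _)
          fun _ _ _ => sq_nonneg _
  have hcs := sq_sum_le_card_mul_sum_sq (s := Finset.univ)
    (f := fun i => |inner ℝ (row (debias A) i) v|)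
  rw [Finset.card_univ, Fintype.card_fin] at hcs
  rcases Nat.eq_zero_or_pos (m / 2) with h0 | h0
  · simp [h0]
  have hN : (0 : ℝ) < (m / 2 : ℕ) := by exact_mod_cast h0
  rw [inv_mul_le_iff₀ (Real.sqrt_pos.2 hN)]
  refine abs_le_of_sq_le_sq' ?_ (by positivity) |>.2
  rw [mul_pow, Real.sq_sqrt hN.le]
  exact hcs.trans (by gcongr)

end Norm

theorem supInner_zero {n : ℕ} {E : Set (EuclideanSpace ℝ (Fin n))} (hE : E.Nonempty) :
    supInner E 0 = 0 := by
  simp [supInner, biSup_const hE]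

theorem inner_h {N n : ℕ} (B : Matrix (Fin N) (Fin n) ℝ) (ε : Fin N → ℝ)
    (u : EuclideanSpace ℝ (Fin n)) :
    inner ℝ (h B ε) u = (√(N : ℝ))⁻¹ * ∑ k, ε k * inner ℝ (row B k) u := by
  simp [h, real_inner_smul_left, sum_inner]

theorem coe_inner_le_supInner {n : ℕ} {E : Set (EuclideanSpace ℝ (Fin n))}
    (x : EuclideanSpace ℝ (Fin n)) {u : EuclideanSpace ℝ (Fin n)} (hu : u ∈ E) :
    ((inner ℝ x u : ℝ) : EReal) ≤ supInner E x :=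
  le_iSup₂ (f := fun (u : EuclideanSpace ℝ (Fin n)) (_ : u ∈ E) => ((inner ℝ x u : ℝ) : EReal)) u hu

/-- This serves the case `m = 1`, where `h` is an empty sum. On empty `E` the supremum would be `⊥`
instead. -/
theorem W_eq_zero {Ω : Type*} [MeasurableSpace Ω] (μ : Measure Ω) {N n : ℕ} (hN : N = 0)
    {E : Set (EuclideanSpace ℝ (Fin n))} (hE : E.Nonempty) (B : Ω → Matrix (Fin N) (Fin n) ℝ) :
    W μ E B = 0 := by
  subst hN
  have : ∀ p : Ω × (Fin 0 → ℝ), supInner E (h (B p.1) p.2) = 0 := fun p => by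
    simp [h, supInner_zero hE]
  simp [W, expectation, this]

/-! ### Integrability and finite maxima from `W`. -/

section RademacherProcess

variable {Ω : Type*} [MeasurableSpace Ω] {μ : Measure Ω} {N n : ℕ}
  {E : Set (EuclideanSpace ℝ (Fin n))} {B : Ω → Matrix (Fin N) (Fin n) ℝ}

/-- Since `∞ - ∞` is excluded, an infinite positive part would force `W = ⊤`. -/
theorem lintegral_supInner_ne_top (hW : WExists μ E B) (hW' : W μ E B ≠ ⊤) :
    ∫⁻ p, (supInner E (h (B p.1) p.2)).toENNReal ∂(μ.prod (rademacherSeq N)) ≠ ∞ := by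
  intro htop
  refine hW' ?_
  have hneg := hW.resolve_left (not_not.2 htop)
  rw [W, expectation, htop, EReal.coe_ennreal_top]
  exact EReal.top_sub (by simpa using hneg)

variable [IsProbabilityMeasure μ] {ν : Measure (EuclideanSpace ℝ (Fin n))}
  [IsProbabilityMeasure ν]

/-- If `W` is finite, then the summands of the Rademacher process are integrable. -/
theorem integrable_mul_inner (hN : 0 < N) (hB : AEMeasurable (fun ω i => row (B ω) i) μ)
    (hlaw : μ.map (fun ω i => row (B ω) i) = Measure.pi fun _ => ν)
    (hW : WExists μ E B) (hW' : W μ E B ≠ ⊤) {u : EuclideanSpace ℝ (Fin n)} (hu : u ∈ E) :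
    Integrable (fun p : EuclideanSpace ℝ (Fin n) × ℝ => p.2 * inner ℝ p.1 u)
      (ν.prod rademacher) := by
  have hsN : 0 < √(N : ℝ) := Real.sqrt_pos.2 (by exact_mod_cast hN)
  obtain ⟨hJ, hJlaw⟩ := map_prod_rademacherSeq hB hlaw
  have hmeas : Measurable fun p : Fin N → EuclideanSpace ℝ (Fin n) × ℝ =>
    ∑ i, (p i).2 * inner ℝ (p i).1 u := by fun_prop
  refine integrable_rademacher_of_lintegral ν (f := fun x => inner ℝ x u) (by fun_prop) hN ?_
  rw [← hJlaw, lintegral_map' hmeas.ennreal_ofReal.aemeasurable hJ]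
  have hle : ∀ p : Ω × (Fin N → ℝ),
      ENNReal.ofReal (∑ i, p.2 i * inner ℝ (row (B p.1) i) u) ≤
        ENNReal.ofReal √(N : ℝ) * (supInner E (h (B p.1) p.2)).toENNReal := fun p => by
    have h1 := EReal.toENNReal_le_toENNReal (coe_inner_le_supInner (h (B p.1) p.2) hu)
    rw [EReal.real_coe_toENNReal, inner_h] at h1
    refine le_trans (le_of_eq ?_) (mul_le_mul_right h1 _)
    rw [← ENNReal.ofReal_mul hsN.le, mul_inv_cancel_left₀ hsN.ne']
  refine ((lintegral_mono hle).trans_lt ?_).ne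
  rw [lintegral_const_mul' _ _ ENNReal.ofReal_ne_top]
  exact ENNReal.mul_lt_top ENNReal.ofReal_lt_top (lintegral_supInner_ne_top hW hW').lt_top

/-- The expectation of the maximum of `⟨h, u⟩` over finitely many points of `E` is at most
`W`, expressed on the space of the vectors and signs. -/
theorem integral_iSup_rademacher_le_W (hB : AEMeasurable (fun ω i => row (B ω) i) μ)
    (hlaw : μ.map (fun ω i => row (B ω) i) = Measure.pi fun _ => ν)
    {ι : Type*} [Finite ι] [Nonempty ι] {u : ι → EuclideanSpace ℝ (Fin n)} (hu : ∀ k, u k ∈ E)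
    (hint : ∀ k, Integrable (fun p : EuclideanSpace ℝ (Fin n) × ℝ => p.2 * inner ℝ p.1 (u k))
      (ν.prod rademacher)) :
    (((√(N : ℝ))⁻¹ * ∫ p, ⨆ k, ∑ i, (p i).2 * inner ℝ (p i).1 (u k)
        ∂(Measure.pi fun _ : Fin N => ν.prod rademacher) : ℝ) : EReal) ≤ W μ E B := by
  obtain ⟨hJ, hJlaw⟩ := map_prod_rademacherSeq hB hlaw
  let M : (Fin N → EuclideanSpace ℝ (Fin n) × ℝ) → ℝ := fun p =>
    (√(N : ℝ))⁻¹ * ⨆ k, ∑ i, (p i).2 * inner ℝ (p i).1 (u k)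
  have hM : Integrable M (Measure.pi fun _ => ν.prod rademacher) :=
    Integrable.const_mul (integrable_iSup fun k => integrable_finsetSum _ fun i _ =>
      integrable_comp_eval (μ := fun _ : Fin N => ν.prod rademacher) (i := i) (hint k)) _
  have hMW : ∀ p : Ω × (Fin N → ℝ), (M (fun i => (row (B p.1) i, p.2 i)) : EReal) ≤
      supInner E (h (B p.1) p.2) := fun p => by
    obtain ⟨k, hk⟩ := exists_eq_ciSup_of_finite
      (f := fun k => ∑ i, p.2 i * inner ℝ (row (B p.1) i) (u k))
    have : M (fun i => (row (B p.1) i, p.2 i)) = inner ℝ (h (B p.1) p.2) (u k) := by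
      simp only [M, ← hk, inner_h]
    rw [this]
    exact coe_inner_le_supInner _ (hu k)
  rw [← integral_const_mul]
  change ((∫ p, M p ∂(Measure.pi fun _ => ν.prod rademacher) : ℝ) : EReal) ≤ _
  rw [← hJlaw] at hM ⊢
  rw [integral_map hJ hM.aestronglyMeasurable]
  exact coe_integral_le_expectation (hM.comp_aemeasurable hJ) hMW

end RademacherProcess

end SmallBall

/-! ### Degenerate cases and passage from finite families to `E`. -/

theorem theorem1 {Ω Ω₀ : Type*} [MeasurableSpace Ω] [MeasurableSpace Ω₀]
    (μ : Measure Ω) [IsProbabilityMeasure μ] (μ₀ : Measure Ω₀) [IsProbabilityMeasure μ₀]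
    {m n : ℕ} (hm : 1 ≤ m) (E : Set (EuclideanSpace ℝ (Fin n)))
    (a : Ω₀ → EuclideanSpace ℝ (Fin n)) (A : Ω → Matrix (Fin m) (Fin n) ℝ)
    (hindep : iIndepFun (fun i ω => SmallBall.row (A ω) i) μ)
    (hcopies : ∀ i, IdentDistrib (fun ω => SmallBall.row (A ω) i) a μ μ₀)
    (hW : SmallBall.WExists μ E (fun ω => SmallBall.debias (A ω)))
    (t ξ : ℝ) (ht : 0 < t) (hξ : 0 < ξ) :
    1 - Real.exp (-2 * t ^ 2) ≤
      μ.real {ω |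
        ((ξ * √(((m : ℝ) - 1) / 2) *
            SmallBall.Q (μ₀.prod μ₀) (2 * ξ) E (SmallBall.debiasedVector a) - ξ * t : ℝ) : EReal)
          - 2 * SmallBall.W μ E (fun ω => SmallBall.debias (A ω))
        ≤ ⨅ v ∈ E, ((‖Matrix.toEuclideanLin (A ω) v‖ : ℝ) : EReal)} := by
  set q := SmallBall.Q (μ₀.prod μ₀) (2 * ξ) E (SmallBall.debiasedVector a) with hq
  have htriv : ∀ {s : Set Ω}, (∀ ω, ω ∈ s) → 1 - Real.exp (-2 * t ^ 2) ≤ μ.real s := fun hs => by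
    rw [Set.eq_univ_of_forall hs, probReal_univ]
    linarith [Real.exp_nonneg (-2 * t ^ 2)]
  rcases E.eq_empty_or_nonempty with rfl | hE
  · exact htriv fun ω => by simp
  rcases Nat.eq_zero_or_pos (m / 2) with h0 | hN
  -- There are no pairs, and the lower bound is the negative number `-ξ t`.
  · obtain rfl : m = 1 := by omega
    refine htriv fun ω => ?_
    rw [Set.mem_ofPred_eq, SmallBall.W_eq_zero μ h0 hE]
    refine le_iInf₂ fun v _ => ?_
    have : ξ * √(((1 : ℕ) - 1 : ℝ) / 2) * q - ξ * t ≤ ‖Matrix.toEuclideanLin (A ω) v‖ := by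
      have := mul_pos hξ ht
      have := norm_nonneg (Matrix.toEuclideanLin (A ω) v)
      simp only [Nat.cast_one, sub_self, zero_div, Real.sqrt_zero, mul_zero, zero_mul]
      linarith
    simpa only [mul_zero, sub_zero] using EReal.coe_le_coe_iff.2 this
  by_cases hWtop : SmallBall.W μ E (fun ω => SmallBall.debias (A ω)) = ⊤
  -- The lower bound is `⊥`.
  · refine htriv fun ω => ?_
    rw [Set.mem_ofPred_eq, hWtop, EReal.mul_top_of_pos (by norm_num), EReal.sub_top]
    exact bot_le
  have ha : AEMeasurable a μ₀ := (hcopies ⟨0, hm⟩).aemeasurable_snd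
  have hb := SmallBall.aemeasurable_row_debias fun i => (hcopies i).aemeasurable_fst
  have hlaw := SmallBall.map_row_debias hindep hcopies ha
  have hd := (SmallBall.map_debiasedVector ha).1
  set ν := (μ₀.prod μ₀).map (SmallBall.debiasedVector a) with hν
  have : IsProbabilityMeasure ν := Measure.isProbabilityMeasure_map hd
  have : Nonempty E := hE.to_subtype
  let d : ℕ → E := TopologicalSpace.denseSeq E
  have hint := fun k : ℕ => SmallBall.integrable_mul_inner hN hb hlaw hW hWtop (d k).2
  have hfin := fun k : ℕ => SmallBall.integral_iSup_rademacher_le_W hb hlaw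
    (u := fun j : Fin (k + 1) => (d j : EuclideanSpace ℝ (Fin n))) (fun j => (d j).2)
    fun j => hint j
  -- A single point of `E` already bounds `W` below by a real number.
  have hWbot : SmallBall.W μ E (fun ω => SmallBall.debias (A ω)) ≠ ⊥ :=
    ne_bot_of_le_ne_bot (EReal.coe_ne_bot _) (hfin 0)
  obtain ⟨w, hw⟩ : ∃ w : ℝ, (w : EReal) = SmallBall.W μ E (fun ω => SmallBall.debias (A ω)) :=
    ⟨_, EReal.coe_toReal hWtop hWbot⟩
  have hsN : 0 < √((m / 2 : ℕ) : ℝ) := Real.sqrt_pos.2 (by exact_mod_cast hN)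
  have hqv : ∀ v : E, q ≤ ν.real {x | 2 * ξ ≤ |inner ℝ x v.1|} := fun v => by
    have hms : MeasurableSet {x : EuclideanSpace ℝ (Fin n) | 2 * ξ ≤ |inner ℝ x v.1|} :=
      measurableSet_le measurable_const (by fun_prop)
    rw [hν, map_measureReal_apply_of_aemeasurable hd hms]
    exact ciInf_le ⟨0, by rintro _ ⟨u, rfl⟩; exact measureReal_nonneg⟩ v
  have hq0 : 0 ≤ q := Real.iInf_nonneg fun _ => measureReal_nonneg
  set c : ℝ := ξ * √((m / 2 : ℕ) : ℝ) * q - ξ * t - 2 * w with hc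
  let S : ℕ → Set (Fin (m / 2) → EuclideanSpace ℝ (Fin n)) := fun k =>
    {x | ∀ j : Fin (k + 1), c ≤ (√((m / 2 : ℕ) : ℝ))⁻¹ * ∑ i, |inner ℝ (x i) (d j).1|}
  have hSm : ∀ k, MeasurableSet (S k) := fun k => by
    simp only [S, Set.ofPred_forall]
    exact MeasurableSet.iInter fun j => measurableSet_le measurable_const (by fun_prop)
  have hS : ∀ k, 1 - Real.exp (-2 * t ^ 2) ≤ (Measure.pi fun _ => ν).real (S k) := fun k => by
    refine SmallBall.one_sub_exp_le_measure_finite ν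
      (f := fun (j : Fin (k + 1)) x => inner ℝ x (d j : EuclideanSpace ℝ (Fin n)))
      (fun j => by fun_prop) (fun j => hint j) hN hξ ht
      (fun j => hqv (d j)) ?_
    have := hfin k
    rw [← hw, EReal.coe_le_coe_iff, inv_mul_le_iff₀ hsN] at this
    exact this
  -- The bound of `hS` does not depend on `k`, so it survives the decreasing limit over ever larger
  -- initial pieces of the dense sequence.
  have hanti : Antitone S := fun k l hkl x hx j => hx ⟨j, by omega⟩
  have hlim := tendsto_measure_iInter_atTop (μ := Measure.pi fun _ : Fin (m / 2) => ν)
    (fun k => (hSm k).nullMeasurableSet) hanti ⟨0, measure_ne_top _ _⟩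
  have hinter : 1 - Real.exp (-2 * t ^ 2) ≤ (Measure.pi fun _ => ν).real (⋂ k, S k) :=
    ge_of_tendsto ((ENNReal.tendsto_toReal (measure_ne_top _ _)).comp hlim) (.of_forall hS)
  rw [← hlaw, map_measureReal_apply_of_aemeasurable hb (MeasurableSet.iInter hSm)] at hinter
  refine hinter.trans (measureReal_mono fun ω hω => ?_)
  have hdense : ∀ v : E, c ≤ ‖Matrix.toEuclideanLin (A ω) v‖ := fun v => by
    refine (TopologicalSpace.denseRange_denseSeq E).induction_on
      (p := fun v : E => c ≤ ‖Matrix.toEuclideanLin (A ω) v‖) v ?_ fun k => ?_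
    · exact isClosed_le continuous_const
        ((Matrix.toEuclideanLin (A ω)).continuous_of_finiteDimensional.comp
          continuous_subtype_val).norm
    · exact (Set.mem_iInter.1 hω k ⟨k, by omega⟩).trans
        (SmallBall.inv_sqrt_mul_sum_abs_inner_le_norm (A ω) _)
  rw [Set.mem_ofPred_eq, ← hw]
  refine le_iInf₂ fun v hv => ?_
  -- This is where `⌊m/2⌋ ≥ (m - 1) / 2` enters; `hq0` preserves the direction of the inequality.
  have hroot : √(((m : ℝ) - 1) / 2) ≤ √((m / 2 : ℕ) : ℝ) := by
    refine Real.sqrt_le_sqrt ?_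
    have : (m : ℝ) ≤ 2 * (m / 2 : ℕ) + 1 := by exact_mod_cast (by omega : m ≤ 2 * (m / 2) + 1)
    linarith
  have hfinal : ξ * √(((m : ℝ) - 1) / 2) * q - ξ * t - 2 * w ≤
      ‖Matrix.toEuclideanLin (A ω) v‖ := by
    refine le_trans ?_ (hdense ⟨v, hv⟩)
    rw [hc]
    gcongr
  simpa using! EReal.coe_le_coe_iff.2 hfinal
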